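/- Let $p<q$ be real numbers and $I=[p,q)$. An interval exchange transformation of $I$ is a bijection $f:I\to I$ for which there are points $p=p_0<p_1<\dots<p_k=q$ such that the restriction of $f$ to each $[p_{i-1},p_i)$, $1\le i\le k$, is a translation. Let $\mathcal G_I$ be the group of all interval exchange transformations of $I$ under composition. Then the commutator subgroup $[\mathcal G_I,\mathcal G_I]$ is a simple group, i.e. it is nontrivial and its only normal subgroups are the trivial subgroup and itself. -/

import Mathlib

/-- A bijection `f` of the half-open interval `[p, q)` is an interval exchange transformation if
there are `k` and points `p = P 0 < P 1 < ⋯ < P k = q` such that the restriction of `f` to each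
`[P i, P (i + 1))` is a translation. (The images of these subintervals form a partition of
`[p, q)` because `f` is a bijection.) -/
def IsIntervalExchange (p q : ℝ) (f : Equiv.Perm (Set.Ico p q)) : Prop :=
  ∃ (k : ℕ) (P : Fin (k + 1) → ℝ), StrictMono P ∧ P 0 = p ∧ P (Fin.last k) = q ∧
    ∃ t : Fin k → ℝ, ∀ (i : Fin k) (x : Set.Ico p q),
      (x : ℝ) ∈ Set.Ico (P i.castSucc) (P i.succ) → (f x : ℝ) = x + t i

namespace IsIntervalExchange

theorem exists_piece : ∀ (k : ℕ) (P : Fin (k + 1) → ℝ) (x : ℝ), P 0 ≤ x → x < P (Fin.last k) →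
    ∃ i : Fin k, x ∈ Set.Ico (P i.castSucc) (P i.succ) := by
  intro k
  induction k with
  | zero =>
    intro P x h0 h1
    exact absurd (lt_of_le_of_lt h0 h1) (lt_irrefl _)
  | succ k ih =>
    intro P x h0 h1
    by_cases h : x < P (Fin.last k).castSucc
    · obtain ⟨i, hi⟩ := ih (fun j => P j.castSucc) x h0 h
      exact ⟨i.castSucc, hi⟩
    · exact ⟨Fin.last k, not_lt.mp h, h1⟩

/-- The condition in terms of a finite set of break points: `f` has constant displacement between
any two points that are not separated by a break point. -/
theorem iff_finset {p q : ℝ} (hpq : p < q) (f : Equiv.Perm (Set.Ico p q)) :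
    IsIntervalExchange p q f ↔ ∃ S : Finset ℝ, ∀ x y : Set.Ico p q, (x : ℝ) ≤ y →
      (∀ s ∈ S, (x : ℝ) < s → (y : ℝ) < s) → (f y : ℝ) = f x + (y - x) := by
  constructor
  · rintro ⟨k, P, -, h0, h1, t, ht⟩
    refine ⟨Finset.univ.image P, fun x y hxy hS => ?_⟩
    obtain ⟨i, hi⟩ := exists_piece k P x (h0 ▸ x.2.1) (h1 ▸ x.2.2)
    have hy : (y : ℝ) < P i.succ := hS _ (by simp) hi.2
    rw [ht i x hi, ht i y ⟨hi.1.trans hxy, hy⟩]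
    ring
  · rintro ⟨S, hS⟩
    set T : Finset ℝ := insert p (insert q (S.filter fun s => p < s ∧ s < q)) with hT
    have hpT : p ∈ T := by simp [hT]
    have hqT : q ∈ T := by simp [hT]
    have hTb : ∀ s ∈ T, p ≤ s ∧ s ≤ q := by
      intro s hs
      simp only [hT, Finset.mem_insert, Finset.mem_filter] at hs
      rcases hs with rfl | rfl | ⟨-, h, h'⟩
      · exact ⟨le_rfl, hpq.le⟩
      · exact ⟨hpq.le, le_rfl⟩
      · exact ⟨h.le, h'.le⟩
    have hcard : T.card = (T.card - 1) + 1 :=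
      (Nat.sub_add_cancel (Finset.card_pos.mpr ⟨p, hpT⟩)).symm
    set P := T.orderEmbOfFin hcard with hP
    have hmem : ∀ i, P i ∈ T := fun i => T.orderEmbOfFin_mem hcard i
    have hsurj : ∀ s ∈ T, ∃ i, P i = s := by
      intro s hs
      have : s ∈ Set.range P := by rw [hP, Finset.range_orderEmbOfFin]; exact hs
      exact this
    have hP0 : P 0 = p := by
      obtain ⟨i, hi⟩ := hsurj p hpT
      exact le_antisymm (hi ▸ P.monotone (Fin.zero_le i)) (hTb _ (hmem 0)).1
    have hPl : P (Fin.last _) = q := by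
      obtain ⟨i, hi⟩ := hsurj q hqT
      exact le_antisymm (hTb _ (hmem _)).2 (hi ▸ P.monotone (Fin.le_last i))
    have hleft : ∀ i : Fin (T.card - 1), P i.castSucc ∈ Set.Ico p q := fun i =>
      ⟨(hTb _ (hmem _)).1, lt_of_lt_of_le (P.strictMono i.castSucc_lt_succ) (hTb _ (hmem _)).2⟩
    refine ⟨T.card - 1, P, P.strictMono, hP0, hPl,
      fun i => (f ⟨P i.castSucc, hleft i⟩ : ℝ) - P i.castSucc, fun i x hx => ?_⟩
    rw [hS ⟨P i.castSucc, hleft i⟩ x hx.1]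
    · ring
    · intro s hs h1
      by_contra h2
      have h2 : s ≤ x := not_lt.mp h2
      have hsT : s ∈ T := by
        simp only [hT, Finset.mem_insert, Finset.mem_filter]
        exact Or.inr (Or.inr ⟨hs, lt_of_le_of_lt (hleft i).1 h1, lt_of_le_of_lt h2 x.2.2⟩)
      obtain ⟨j, rfl⟩ := hsurj s hsT
      have hij : i.castSucc < j := P.strictMono.lt_iff_lt.mp h1
      have hji : j < i.succ := P.strictMono.lt_iff_lt.mp (lt_of_le_of_lt h2 hx.2)
      rw [Fin.lt_def] at hij hji
      simp at hij hji
      omega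

theorem one {p q : ℝ} (hpq : p < q) : IsIntervalExchange p q 1 :=
  (iff_finset hpq 1).2 ⟨∅, fun x y _ _ => by simp⟩

theorem mul {p q : ℝ} (hpq : p < q) {f g : Equiv.Perm (Set.Ico p q)}
    (hf : IsIntervalExchange p q f) (hg : IsIntervalExchange p q g) :
    IsIntervalExchange p q (f * g) := by
  obtain ⟨S, hS⟩ := (iff_finset hpq f).1 hf
  obtain ⟨R, hR⟩ := (iff_finset hpq g).1 hg
  classical
  refine (iff_finset hpq _).2 ⟨R ∪ S.image (fun s => if h : s ∈ Set.Ico p q then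
    ((g.symm ⟨s, h⟩ : Set.Ico p q) : ℝ) else s), fun x y hxy hB => ?_⟩
  have hgxy := hR x y hxy fun s hs => hB s (Finset.mem_union_left _ hs)
  have hle : (g x : ℝ) ≤ g y := by linarith
  have hfg := hS (g x) (g y) hle fun s hs h1 => by
    by_contra h2
    have h2 : s ≤ g y := not_lt.mp h2
    have hsI : s ∈ Set.Ico p q := ⟨(g x).2.1.trans h1.le, lt_of_le_of_lt h2 (g y).2.2⟩
    have hzI : (x : ℝ) + (s - g x) ∈ Set.Ico p q :=
      ⟨by linarith [x.2.1], lt_of_le_of_lt (by linarith) y.2.2⟩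
    have hz := hR x ⟨_, hzI⟩ (by simp only; linarith) fun r hr hxr =>
      lt_of_le_of_lt (by simp only; linarith) (hB r (Finset.mem_union_left _ hr) hxr)
    have hz' : g ⟨_, hzI⟩ = ⟨s, hsI⟩ := Subtype.ext (by rw [hz]; simp)
    have hzs : g.symm ⟨s, hsI⟩ = ⟨_, hzI⟩ := by rw [← hz', Equiv.symm_apply_apply]
    have := hB ((x : ℝ) + (s - g x)) (Finset.mem_union_right _ (Finset.mem_image.2
      ⟨s, hs, by rw [dif_pos hsI, hzs]⟩)) (by linarith)
    linarith
  simp only [Equiv.Perm.mul_apply]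
  linarith

theorem inv {p q : ℝ} (hpq : p < q) {f : Equiv.Perm (Set.Ico p q)}
    (hf : IsIntervalExchange p q f) : IsIntervalExchange p q f⁻¹ := by
  obtain ⟨k, P, hP, h0, h1, t, ht⟩ := hf
  refine (iff_finset hpq _).2 ⟨Finset.univ.image fun i : Fin k => P i.succ + t i,
    fun x y hxy hS => ?_⟩
  obtain ⟨u, rfl⟩ := f.surjective x
  obtain ⟨i, hi⟩ := exists_piece k P u (h0 ▸ u.2.1) (h1 ▸ u.2.2)
  have hu := ht i u hi
  have hy : (y : ℝ) < P i.succ + t i := hS _ (by simp) (by linarith [hi.2])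
  have hq : P i.succ ≤ q := h1 ▸ hP.monotone (Fin.le_last _)
  have hvI : (y : ℝ) - t i ∈ Set.Ico p q := ⟨by linarith [u.2.1], by linarith⟩
  have hv : f ⟨_, hvI⟩ = y := Subtype.ext <| by
    rw [ht i ⟨_, hvI⟩ ⟨by simp only; linarith [hi.1], by simp only; linarith⟩]
    simp
  have hy' : f⁻¹ y = ⟨_, hvI⟩ := f.injective (by rw [hv]; exact f.apply_symm_apply y)
  have hu' : f⁻¹ (f u) = u := f.symm_apply_apply u
  rw [hy', hu', hu]
  simp only
  ring

end IsIntervalExchange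

/-- The group of interval exchange transformations of `[p, q)`, under composition. -/
def intervalExchangeGroup (p q : ℝ) (hpq : p < q) : Subgroup (Equiv.Perm (Set.Ico p q)) where
  carrier := {f | IsIntervalExchange p q f}
  one_mem' := IsIntervalExchange.one hpq
  mul_mem' := IsIntervalExchange.mul hpq
  inv_mem' := IsIntervalExchange.inv hpq

/-! Write G for the whole group and G' for its commutator subgroup. It suffices that any subgroup N
≠ 1 normalized by G' contains G'. Normality in G is not available, so every conjugation must be
arranged to be by an element of G'.

A nontrivial n in N moves some interval off itself; cut that interval into thirds J, K, L. For s, t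
supported in J, the products of s⁻¹ with a copy of s in K, and of t with a copy of t⁻¹ in L, are
themselves commutators. The double commutator of n with them lies in N, and disjointness of supports
reduces it to `⁅s, t⁆` (`commutator_commutator_eq`, `commutator_mem_of_displacement`).

G is generated by swaps of adjacent intervals with arbitrarily small support
(`closure_smallRotations`). Two such swaps either have disjoint supports and commute, or can be
conjugated together into J. Each can also be conjugated off J, so conjugation by G on elements
supported in J reduces to conjugation by G'. Hence N contains the normal closure in G of all `⁅s,
t⁆` supported in J; modulo it the generators commute, so it contains G'
(`commutator_le_of_displacement`). -/

open scoped commutatorElement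

/-! ### A simplicity criterion for commutator subgroups of permutation groups -/

section SimplicityCriterion

variable {G α : Type*} [Group G] [MulAction G α]

/-- The element `g` moves only points of `A`. -/
def SupportedIn (g : G) (A : Set α) : Prop := ∀ x, x ∉ A → g • x = x

namespace SupportedIn

theorem mono {g : G} {A B : Set α} (h : SupportedIn g A) (hAB : A ⊆ B) : SupportedIn g B :=
  fun x hx => h x fun hA => hx (hAB hA)

theorem inv {g : G} {A : Set α} (h : SupportedIn g A) : SupportedIn g⁻¹ A :=
  fun x hx => by rw [inv_smul_eq_iff, h x hx]

theorem mul {g k : G} {A : Set α} (hg : SupportedIn g A) (hk : SupportedIn k A) :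
    SupportedIn (g * k) A :=
  fun x hx => by rw [mul_smul, hk x hx, hg x hx]

theorem conj {s g : G} {A B : Set α} (h : SupportedIn s A) (hg : ∀ x ∈ A, g • x ∈ B) :
    SupportedIn (g * s * g⁻¹) B := by
  intro x hx
  have : g⁻¹ • x ∉ A := fun hA => hx (by simpa using hg _ hA)
  rw [mul_smul, mul_smul, h _ this, smul_inv_smul]

theorem smul_mem {g : G} {A : Set α} (h : SupportedIn g A) {x : α} (hx : x ∈ A) : g • x ∈ A := by
  by_contra hn
  have := h.inv _ hn
  rw [inv_smul_smul] at this
  exact hn (this ▸ hx)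

theorem commute [FaithfulSMul G α] {s t : G} {A B : Set α} (hs : SupportedIn s A)
    (ht : SupportedIn t B) (hAB : Disjoint A B) : Commute s t := by
  refine FaithfulSMul.eq_of_smul_eq_smul (α := α) fun x => ?_
  rw [mul_smul, mul_smul]
  by_cases hA : x ∈ A
  · rw [ht x (Set.disjoint_left.1 hAB hA), ht _ (Set.disjoint_left.1 hAB (hs.smul_mem hA))]
  · rw [hs x hA]
    by_cases hB : x ∈ B
    · rw [hs _ (Set.disjoint_right.1 hAB (ht.smul_mem hB))]
    · rw [ht x hB, hs x hA]

end SupportedIn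

/-- The quotient by `M` is generated by pairwise commuting elements, hence abelian. -/
theorem commutator_le_of_closure_eq_top {M : Subgroup G} [M.Normal] {S : Set G}
    (hS : Subgroup.closure S = ⊤) (h : ∀ s ∈ S, ∀ t ∈ S, ⁅s, t⁆ ∈ M) : commutator G ≤ M := by
  have key : ∀ s ∈ S, ∀ t ∈ S, Commute (s : G ⧸ M) (t : G ⧸ M) := by
    intro s hs t ht
    have := (QuotientGroup.eq_one_iff (N := M) _).2 (h s hs t ht)
    rw [← commutatorElement_eq_one_iff_commute]
    exact this
  have h1 : ∀ g : G, ∀ t ∈ S, Commute (g : G ⧸ M) (t : G ⧸ M) := by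
    intro g t ht
    have hg : g ∈ Subgroup.closure S := hS ▸ Subgroup.mem_top g
    induction hg using Subgroup.closure_induction with
    | mem x hx => exact key x hx t ht
    | one => exact Commute.one_left _
    | mul x y _ _ hx hy => exact hx.mul_left hy
    | inv x _ hx => exact hx.inv_left
  have h2 : ∀ g k : G, Commute (g : G ⧸ M) (k : G ⧸ M) := by
    intro g k
    have hk : k ∈ Subgroup.closure S := hS ▸ Subgroup.mem_top k
    induction hk using Subgroup.closure_induction with
    | mem x hx => exact h1 g x hx
    | one => exact Commute.one_right _
    | mul x y _ _ hx hy => exact hx.mul_right hy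
    | inv x _ hx => exact hx.inv_right
  rw [commutator_def, Subgroup.commutator_le]
  intro g _ k _
  rw [← QuotientGroup.eq_one_iff (N := M)]
  exact commutatorElement_eq_one_iff_commute.2 (h2 g k)

/-- A double commutator trick: `⁅⁅n, s₁⁆, t₁⁆` recovers `⁅s, t⁆` when the auxiliary factors
commute. -/
theorem commutator_commutator_eq {n s t a b : G} (has : Commute a s) (hat : Commute a t)
    (hab : Commute a b) (hbs : Commute b s)
    (hus : Commute (n * (s⁻¹ * a) * n⁻¹) (s⁻¹ * a)) (hut : Commute (n * (s⁻¹ * a) * n⁻¹) (t * b)) :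
    ⁅⁅n, s⁻¹ * a⁆, t * b⁆ = ⁅s, t⁆ := by
  set u := n * (s⁻¹ * a) * n⁻¹ with hu
  set v := s⁻¹ * a with hv
  have h1 : ⁅n, v⁆ = u * v⁻¹ := by rw [commutatorElement_def]
  have h2 : ⁅u * v⁻¹, t * b⁆ = ⁅v⁻¹, t * b⁆ := by
    -- As `u` commutes with both `v` and `t * b`, it drops out of the outer commutator.
    have hw : Commute u (v⁻¹ * (t * b) * v) := (hus.inv_right.mul_right hut).mul_right hus
    calc ⁅u * v⁻¹, t * b⁆ = u * (v⁻¹ * (t * b) * v) * u⁻¹ * (t * b)⁻¹ := by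
          rw [commutatorElement_def]; group
      _ = (v⁻¹ * (t * b) * v) * u * u⁻¹ * (t * b)⁻¹ := by rw [hw.eq]
      _ = ⁅v⁻¹, t * b⁆ := by rw [commutatorElement_def]; group
  have h3 : ⁅v⁻¹, t * b⁆ = ⁅s, t⁆ := by
    have hw : Commute a⁻¹ (s * (t * b) * s⁻¹) :=
      ((has.mul_right (hat.mul_right hab)).mul_right has.inv_right).inv_left
    have hb : Commute b s⁻¹ := hbs.inv_right
    calc ⁅v⁻¹, t * b⁆ = a⁻¹ * (s * (t * b) * s⁻¹) * a * (t * b)⁻¹ := by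
          rw [commutatorElement_def, hv]; group
      _ = (s * (t * b) * s⁻¹) * a⁻¹ * a * (t * b)⁻¹ := by rw [hw.eq]
      _ = s * t * (b * s⁻¹) * b⁻¹ * t⁻¹ := by group
      _ = s * t * (s⁻¹ * b) * b⁻¹ * t⁻¹ := by rw [hb.eq]
      _ = ⁅s, t⁆ := by rw [commutatorElement_def]; group
  rw [h1, h2, h3]

/-- `s` and `t` need not lie in the commutator subgroup, but their products with inverse copies
carried to `K` and `L` do, so they may be used against `N`. The displacement by `n` makes the
conjugated factor disjoint from everything else. -/
theorem commutator_mem_of_displacement [FaithfulSMul G α] {N : Subgroup G}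
    (hN : ∀ g ∈ commutator G, ∀ n ∈ N, g * n * g⁻¹ ∈ N) {n : G} (hn : n ∈ N) {J K L : Set α}
    (hJK : Disjoint J K) (hJL : Disjoint J L) (hKL : Disjoint K L)
    (hdis : ∀ x ∈ J ∪ K, n • x ∉ J ∪ K ∪ L) {h k : G} (hh : ∀ x ∈ J, h • x ∈ K)
    (hk : ∀ x ∈ J, k • x ∈ L) {s t : G} (hs : SupportedIn s J) (ht : SupportedIn t J) :
    ⁅s, t⁆ ∈ N := by
  have ha : SupportedIn (h * s * h⁻¹) K := hs.conj hh
  have hb : SupportedIn (k * t⁻¹ * k⁻¹) L := ht.inv.conj hk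
  have hv : SupportedIn (s⁻¹ * (h * s * h⁻¹)) (J ∪ K) :=
    (hs.inv.mono Set.subset_union_left).mul (ha.mono Set.subset_union_right)
  have hw : SupportedIn (t * (k * t⁻¹ * k⁻¹)) (J ∪ K ∪ L) :=
    (ht.mono fun _ hx => Or.inl (Or.inl hx)).mul (hb.mono Set.subset_union_right)
  have hu : SupportedIn (n * (s⁻¹ * (h * s * h⁻¹)) * n⁻¹) (J ∪ K ∪ L)ᶜ := hv.conj hdis
  rw [← commutator_commutator_eq (n := n) (ha.commute hs hJK.symm) (ha.commute ht hJK.symm)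
    (ha.commute hb hKL) (hb.commute hs hJL.symm)
    (hu.commute (hv.mono Set.subset_union_left) disjoint_compl_left)
    (hu.commute hw disjoint_compl_left)]
  have hvG : s⁻¹ * (h * s * h⁻¹) ∈ commutator G := by
    have : s⁻¹ * (h * s * h⁻¹) = ⁅s⁻¹, h⁆ := by rw [commutatorElement_def]; group
    rw [this]
    exact Subgroup.commutator_mem_commutator (Subgroup.mem_top _) (Subgroup.mem_top _)
  have hwG : t * (k * t⁻¹ * k⁻¹) ∈ commutator G := by
    have : t * (k * t⁻¹ * k⁻¹) = ⁅t, k⁆ := by rw [commutatorElement_def]; group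
    rw [this]
    exact Subgroup.commutator_mem_commutator (Subgroup.mem_top _) (Subgroup.mem_top _)
  have h1 : ∀ g ∈ commutator G, ∀ m ∈ N, ⁅m, g⁆ ∈ N := by
    intro g hg m hm
    have : ⁅m, g⁆ = m * (g * m⁻¹ * g⁻¹) := by rw [commutatorElement_def]; group
    rw [this]
    exact N.mul_mem hm (hN g hg _ (N.inv_mem hm))
  exact h1 _ hwG _ (h1 _ hvG _ hn)

/-- A subgroup normalized by the commutator subgroup contains it as soon as some element of it
displaces a set `J` (with two disjoint copies) and the group is generated by elements that can be
moved off `J`, with any two that do not commute simultaneously movable into `J`. -/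
theorem commutator_le_of_displacement [FaithfulSMul G α] {N : Subgroup G}
    (hN : ∀ g ∈ commutator G, ∀ n ∈ N, g * n * g⁻¹ ∈ N) {n : G} (hn : n ∈ N) {J K L : Set α}
    (hJK : Disjoint J K) (hJL : Disjoint J L) (hKL : Disjoint K L)
    (hdis : ∀ x ∈ J ∪ K, n • x ∉ J ∪ K ∪ L) {h k : G} (hh : ∀ x ∈ J, h • x ∈ K)
    (hk : ∀ x ∈ J, k • x ∈ L) {S : Set G} (hS : Subgroup.closure S = ⊤)
    (hoff : ∀ s ∈ S, ∃ g : G, SupportedIn (g * s * g⁻¹) Jᶜ)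
    (hin : ∀ s ∈ S, ∀ t ∈ S, Commute s t ∨
      ∃ g : G, SupportedIn (g * s * g⁻¹) J ∧ SupportedIn (g * t * g⁻¹) J) :
    commutator G ≤ N := by
  have hbase : ∀ s t : G, SupportedIn s J → SupportedIn t J → ⁅s, t⁆ ∈ N := fun s t hs ht =>
    commutator_mem_of_displacement hN hn hJK hJL hKL hdis hh hk hs ht
  let F : Subgroup G :=
    { carrier := {g | SupportedIn g Jᶜ}
      one_mem' := fun x _ => one_smul G x
      mul_mem' := fun ha hb => SupportedIn.mul ha hb
      inv_mem' := fun ha => SupportedIn.inv ha }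
  -- Modulo commutators each generator equals a conjugate of itself that fixes `J` pointwise.
  have htop : commutator G ⊔ F = ⊤ := by
    rw [eq_top_iff, ← hS, Subgroup.closure_le]
    intro s hs
    obtain ⟨g, hg⟩ := hoff s hs
    have hsg : s = ⁅s, g⁆ * (g * s * g⁻¹) := by rw [commutatorElement_def]; group
    rw [hsg]
    exact Subgroup.mul_mem_sup
      (Subgroup.commutator_mem_commutator (Subgroup.mem_top _) (Subgroup.mem_top _)) hg
  -- The factor of `g` in `F` centralizes `⁅s, t⁆`, leaving conjugation by a commutator-subgroup
  -- element, which preserves `N`.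
  have hconj : ∀ g s t : G, SupportedIn s J → SupportedIn t J → g * ⁅s, t⁆ * g⁻¹ ∈ N := by
    intro g s t hs ht
    have hg : g ∈ commutator G ⊔ F := htop ▸ Subgroup.mem_top g
    obtain ⟨c, hc, u, hu, rfl⟩ := Subgroup.mem_sup_of_normal_left.1 hg
    have hu : SupportedIn u Jᶜ := hu
    have hst : SupportedIn ⁅s, t⁆ J := ((hs.mul ht).mul hs.inv).mul ht.inv
    have hcomm : Commute u ⁅s, t⁆ := hu.commute hst disjoint_compl_left
    have : c * u * ⁅s, t⁆ * (c * u)⁻¹ = c * ⁅s, t⁆ * c⁻¹ := by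
      calc c * u * ⁅s, t⁆ * (c * u)⁻¹ = c * (u * ⁅s, t⁆) * u⁻¹ * c⁻¹ := by group
        _ = c * (⁅s, t⁆ * u) * u⁻¹ * c⁻¹ := by rw [hcomm.eq]
        _ = c * ⁅s, t⁆ * c⁻¹ := by group
    rw [this]
    exact hN c hc _ (hbase s t hs ht)
  let C : Set G := {g | ∃ s t : G, SupportedIn s J ∧ SupportedIn t J ∧ g = ⁅s, t⁆}
  have hM : commutator G ≤ Subgroup.normalClosure C := by
    refine commutator_le_of_closure_eq_top hS fun s hs t ht => ?_
    rcases hin s hs t ht with hst | ⟨g, hgs, hgt⟩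
    · rw [commutatorElement_eq_one_iff_commute.2 hst]
      exact Subgroup.one_mem _
    · have : ⁅s, t⁆ = g⁻¹ * ⁅g * s * g⁻¹, g * t * g⁻¹⁆ * g⁻¹⁻¹ := by
        simp only [commutatorElement_def]; group
      rw [this]
      exact Subgroup.normalClosure_normal.conj_mem
        _ (Subgroup.subset_normalClosure (s := C) ⟨_, _, hgs, hgt, rfl⟩) _
  refine hM.trans ?_
  rw [Subgroup.normalClosure, Subgroup.closure_le]
  intro x hx
  obtain ⟨y, ⟨s, t, hs, ht, rfl⟩, hy⟩ := Group.mem_conjugatesOfSet_iff.1 hx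
  obtain ⟨g, rfl⟩ := isConj_iff.1 hy
  exact hconj g s t hs ht

/-- A normal subgroup of `commutator G`, pushed into `G`, is only known to be normalized by
`commutator G`; hence the form of the hypothesis. -/
theorem isSimpleGroup_commutator_of_forall (hne : ∃ s t : G, ¬ Commute s t)
    (h : ∀ N : Subgroup G, (∀ g ∈ commutator G, ∀ n ∈ N, g * n * g⁻¹ ∈ N) →
      ∀ n ∈ N, n ≠ 1 → commutator G ≤ N) : IsSimpleGroup (commutator G) := by
  obtain ⟨s, t, hst⟩ := hne
  refine { exists_pair_ne := ⟨⟨⁅s, t⁆, Subgroup.commutator_mem_commutator (Subgroup.mem_top _)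
    (Subgroup.mem_top _)⟩, 1, fun he => hst ?_⟩, eq_bot_or_eq_top_of_normal := fun N hN => ?_ }
  · exact commutatorElement_eq_one_iff_commute.1 (congrArg Subtype.val he)
  · refine or_iff_not_imp_left.2 fun hbot => ?_
    obtain ⟨n, hn, hn1⟩ := N.bot_or_exists_ne_one.resolve_left hbot
    have hle := h (N.map (commutator G).subtype) (by
      rintro g hg _ ⟨m, hm, rfl⟩
      exact ⟨⟨g, hg⟩ * m * ⟨g, hg⟩⁻¹, hN.conj_mem m hm _, rfl⟩) n ⟨n, hn, rfl⟩
      (fun he => hn1 (Subtype.ext he))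
    rw [eq_top_iff]
    rintro x -
    obtain ⟨y, hy, hyx⟩ := hle x.2
    exact (Subtype.ext hyx : y = x) ▸ hy

end SimplicityCriterion

/-! ### Swaps of two adjacent intervals -/

/-- The map exchanging the adjacent intervals `[a, b)` and `[b, c)`. -/
noncomputable def rotationFun (a b c x : ℝ) : ℝ :=
  if x < a ∨ c ≤ x then x else if x < b then x + (c - b) else x - (b - a)

theorem rotationFun_of_lt {a b c x : ℝ} (h : x < a) : rotationFun a b c x = x := by
  simp [rotationFun, h]

theorem rotationFun_of_ge {a b c x : ℝ} (h : c ≤ x) : rotationFun a b c x = x := by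
  simp [rotationFun, h]

theorem rotationFun_left {a b c x : ℝ} (h₁ : a ≤ x) (h₂ : x < b) (h₃ : b ≤ c) :
    rotationFun a b c x = x + (c - b) := by
  rw [rotationFun, if_neg (by push Not; exact ⟨h₁, by linarith⟩), if_pos h₂]

theorem rotationFun_right {a b c x : ℝ} (h₁ : a ≤ b) (h₂ : b ≤ x) (h₃ : x < c) :
    rotationFun a b c x = x - (b - a) := by
  rw [rotationFun, if_neg (by push Not; exact ⟨by linarith, h₃⟩), if_neg (by linarith)]

theorem rotationFun_cases {a b c : ℝ} (hab : a ≤ b) (hbc : b ≤ c) (x : ℝ) :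
    ((x < a ∨ c ≤ x) ∧ rotationFun a b c x = x) ∨
      (a ≤ x ∧ x < b ∧ rotationFun a b c x = x + (c - b)) ∨
      (b ≤ x ∧ x < c ∧ rotationFun a b c x = x - (b - a)) := by
  rcases lt_or_ge x a with h | h
  · exact Or.inl ⟨Or.inl h, rotationFun_of_lt h⟩
  rcases lt_or_ge x b with h' | h'
  · exact Or.inr (Or.inl ⟨h, h', rotationFun_left h h' hbc⟩)
  rcases lt_or_ge x c with h'' | h''
  · exact Or.inr (Or.inr ⟨h', h'', rotationFun_right hab h' h''⟩)
  · exact Or.inl ⟨Or.inr h'', rotationFun_of_ge h''⟩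

theorem rotationFun_rotationFun {a b c : ℝ} (hab : a ≤ b) (hbc : b ≤ c) (x : ℝ) :
    rotationFun a (a + (c - b)) c (rotationFun a b c x) = x := by
  rcases rotationFun_cases hab hbc x with ⟨h, e⟩ | ⟨h, h', e⟩ | ⟨h, h', e⟩
  · rw [e]
    rcases h with h | h
    · exact rotationFun_of_lt h
    · exact rotationFun_of_ge h
  · rw [e, rotationFun_right (by linarith) (by linarith) (by linarith)]; ring
  · rw [e, rotationFun_left (by linarith) (by linarith) (by linarith)]; ring

theorem rotationFun_mem {p q a b c x : ℝ} (hpa : p ≤ a) (hab : a ≤ b) (hbc : b ≤ c) (hcq : c ≤ q)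
    (hx : x ∈ Set.Ico p q) : rotationFun a b c x ∈ Set.Ico p q := by
  obtain ⟨h₁, h₂⟩ := hx
  rcases rotationFun_cases hab hbc x with ⟨h, e⟩ | ⟨h, h', e⟩ | ⟨h, h', e⟩ <;> rw [e] <;>
    constructor <;> linarith

/-- `g` is the interval exchange swapping `[a, b)` and `[b, c)`. -/
structure IsRotation {p q : ℝ} {hpq : p < q} (g : intervalExchangeGroup p q hpq) (a b c : ℝ) :
    Prop where
  le_left : p ≤ a
  left_le : a ≤ b
  le_right : b ≤ c
  right_le : c ≤ q
  apply_eq : ∀ x : Set.Ico p q, ((g • x : Set.Ico p q) : ℝ) = rotationFun a b c x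

variable {p q : ℝ} {hpq : p < q}

theorem exists_isRotation {a b c : ℝ} (hpa : p ≤ a) (hab : a ≤ b) (hbc : b ≤ c) (hcq : c ≤ q) :
    ∃ g : intervalExchangeGroup p q hpq, IsRotation g a b c := by
  let f : Equiv.Perm (Set.Ico p q) :=
    { toFun := fun x => ⟨rotationFun a b c x, rotationFun_mem hpa hab hbc hcq x.2⟩
      invFun := fun x => ⟨rotationFun a (a + (c - b)) c x,
        rotationFun_mem hpa (by linarith) (by linarith) hcq x.2⟩
      left_inv := fun x => Subtype.ext (rotationFun_rotationFun hab hbc x)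
      right_inv := fun x => Subtype.ext (by
        have := rotationFun_rotationFun (a := a) (b := a + (c - b)) (c := c) (by linarith)
          (by linarith) x
        rwa [show a + (c - (a + (c - b))) = b by ring] at this) }
  have hf : IsIntervalExchange p q f := by
    refine (IsIntervalExchange.iff_finset hpq f).2 ⟨{a, b, c}, fun x y hxy hS => ?_⟩
    have ha := hS a (by simp)
    have hb := hS b (by simp)
    have hc := hS c (by simp)
    change rotationFun a b c y = rotationFun a b c x + (y - x)
    rcases rotationFun_cases hab hbc x with ⟨h | h, e⟩ | ⟨h, h', e⟩ | ⟨h, h', e⟩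
    · rw [e, rotationFun_of_lt (ha h)]; ring
    · rw [e, rotationFun_of_ge (h.trans hxy)]; ring
    · rw [e, rotationFun_left (h.trans hxy) (hb h') hbc]; ring
    · rw [e, rotationFun_right hab (h.trans hxy) (hc h')]; ring
  exact ⟨⟨f, hf⟩, hpa, hab, hbc, hcq, fun _ => rfl⟩

namespace IsRotation

variable {g : intervalExchangeGroup p q hpq} {a b c : ℝ}

theorem supportedIn (h : IsRotation g a b c) :
    SupportedIn g {x : Set.Ico p q | (x : ℝ) ∈ Set.Ico a c} := by
  intro x hx
  refine Subtype.ext ?_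
  rw [h.apply_eq]
  simp only [Set.mem_ofPred_eq, Set.mem_Ico, not_and_or, not_le, not_lt] at hx
  exact hx.elim rotationFun_of_lt rotationFun_of_ge

theorem eq_of_apply {f : intervalExchangeGroup p q hpq} (h : IsRotation g a b c)
    (hf : ∀ x : Set.Ico p q, ((f • x : Set.Ico p q) : ℝ) = rotationFun a b c x) : f = g :=
  FaithfulSMul.eq_of_smul_eq_smul (α := Set.Ico p q) fun x =>
    Subtype.ext ((hf x).trans (h.apply_eq x).symm)

/-- Cutting the left block at `d`: first `[d, b)` jumps over `[b, c)`, then `[a, d)` does. -/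
theorem eq_mul_of_left {d : ℝ} {g₁ g₂ : intervalExchangeGroup p q hpq} (h : IsRotation g a b c)
    (h₁ : IsRotation g₁ a d (d + (c - b))) (h₂ : IsRotation g₂ d b c) : g = g₁ * g₂ := by
  refine (h.eq_of_apply fun x => ?_).symm
  rw [mul_smul, h₁.apply_eq, h₂.apply_eq]
  have i₁ := h₁.left_le
  have i₂ := h₂.left_le
  have i₃ := h₂.le_right
  have i₄ := h.left_le
  rcases rotationFun_cases i₄ i₃ x with ⟨k | k, e⟩ | ⟨k, k', e⟩ | ⟨k, k', e⟩
  · rw [e, rotationFun_of_lt (x := (x : ℝ)) (by linarith), rotationFun_of_lt (by linarith)]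
  · rw [e, rotationFun_of_ge (x := (x : ℝ)) (by linarith), rotationFun_of_ge (by linarith)]
  · rw [e]
    rcases lt_or_ge (x : ℝ) d with hd | hd
    · rw [rotationFun_of_lt hd, rotationFun_left k hd (by linarith)]; ring
    · rw [rotationFun_left hd k' i₃, rotationFun_of_ge (by linarith)]
  · rw [e, rotationFun_right i₂ k k', rotationFun_right i₁ (by linarith) (by linarith)]; ring

/-- Cutting the right block at `d`: `[a, b)` jumps over `[b, d)`, and then, from its new place, over
`[d, c)`. -/
theorem eq_mul_of_right {d : ℝ} {g₁ g₂ : intervalExchangeGroup p q hpq} (h : IsRotation g a b c)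
    (h₁ : IsRotation g₁ (a + (d - b)) d c) (h₂ : IsRotation g₂ a b d) : g = g₁ * g₂ := by
  refine (h.eq_of_apply fun x => ?_).symm
  rw [mul_smul, h₁.apply_eq, h₂.apply_eq]
  have i₁ := h₁.left_le
  have i₂ := h₂.left_le
  have i₃ := h₂.le_right
  have i₄ := h₁.le_right
  rcases rotationFun_cases i₂ (i₃.trans i₄) x with ⟨k | k, e⟩ | ⟨k, k', e⟩ | ⟨k, k', e⟩
  · rw [e, rotationFun_of_lt (x := (x : ℝ)) (by linarith), rotationFun_of_lt (by linarith)]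
  · rw [e, rotationFun_of_ge (x := (x : ℝ)) (by linarith), rotationFun_of_ge (by linarith)]
  · rw [e, rotationFun_left k k' i₃, rotationFun_left (by linarith) (by linarith) i₄]; ring
  · rw [e]
    rcases lt_or_ge (x : ℝ) d with hd | hd
    · rw [rotationFun_right i₂ k hd, rotationFun_of_lt (by linarith)]
    · rw [rotationFun_of_ge hd, rotationFun_right i₁ hd k']; ring

end IsRotation

/-- Any subinterval can be translated onto any other subinterval of the same length. -/
theorem exists_translate {a x l : ℝ} (hpa : p ≤ a) (haq : a + l ≤ q) (hpx : p ≤ x)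
    (hxq : x + l ≤ q) : ∃ g : intervalExchangeGroup p q hpq, ∀ y : Set.Ico p q,
      (y : ℝ) ∈ Set.Ico a (a + l) → ((g • y : Set.Ico p q) : ℝ) = y + (x - a) := by
  rcases lt_or_ge l 0 with hl | hl
  · exact ⟨1, fun y hy => by linarith [hy.1, hy.2]⟩
  -- Swap the interval with the gap between it and its target; this works even if the two overlap.
  rcases le_total x a with h | h
  · obtain ⟨g, hg⟩ := exists_isRotation (hpq := hpq) (a := x) (b := a) (c := a + l) hpx h
      (by linarith) haq
    exact ⟨g, fun y hy => by rw [hg.apply_eq, rotationFun_right h hy.1 hy.2]; ring⟩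
  · obtain ⟨g, hg⟩ := exists_isRotation (hpq := hpq) (a := a) (b := a + l) (c := x + l) hpa
      (by linarith) (by linarith) hxq
    exact ⟨g, fun y hy => by rw [hg.apply_eq, rotationFun_left hy.1 hy.2 (by linarith)]; ring⟩

/-! ### Generation by swaps of small support -/

/-- The rotations supported in an interval of length less than `δ`. -/
def smallRotations (p q : ℝ) (hpq : p < q) (δ : ℝ) : Set (intervalExchangeGroup p q hpq) :=
  {g | ∃ a b c, IsRotation g a b c ∧ c - a < δ}

/-- Halve both blocks repeatedly. Once each has length at most `δ / 3`, the support has length at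
most `2 * δ / 3 < δ`. -/
theorem IsRotation.mem_closure_smallRotations {δ : ℝ} (hδ : 0 < δ) {a b c : ℝ}
    {g : intervalExchangeGroup p q hpq} (hg : IsRotation g a b c) :
    g ∈ Subgroup.closure (smallRotations p q hpq δ) := by
  have key : ∀ n : ℕ, ∀ (a b c : ℝ) (g : intervalExchangeGroup p q hpq), IsRotation g a b c →
      b - a ≤ 2 ^ n * (δ / 3) → c - b ≤ 2 ^ n * (δ / 3) →
      g ∈ Subgroup.closure (smallRotations p q hpq δ) := by
    intro n
    induction n with
    | zero =>
      intro a b c g hg h₁ h₂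
      exact Subgroup.subset_closure ⟨a, b, c, hg, by linarith⟩
    | succ n ih =>
      have half : ∀ (a b c : ℝ) (g : intervalExchangeGroup p q hpq), IsRotation g a b c →
          b - a ≤ 2 ^ n * (δ / 3) → c - b ≤ 2 ^ (n + 1) * (δ / 3) →
          g ∈ Subgroup.closure (smallRotations p q hpq δ) := by
        intro a b c g hg h₁ h₂
        rw [pow_succ] at h₂
        obtain ⟨i₁, i₂, i₃, i₄, -⟩ := id hg
        obtain ⟨g₁, hg₁⟩ := exists_isRotation (hpq := hpq) (a := a + ((b + c) / 2 - b))
          (b := (b + c) / 2) (c := c) (by linarith) (by linarith) (by linarith) (by linarith)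
        obtain ⟨g₂, hg₂⟩ := exists_isRotation (hpq := hpq) (a := a) (b := b)
          (c := (b + c) / 2) (by linarith) (by linarith) (by linarith) (by linarith)
        rw [hg.eq_mul_of_right hg₁ hg₂]
        exact mul_mem (ih _ _ _ _ hg₁ (by linarith) (by linarith))
          (ih _ _ _ _ hg₂ (by linarith) (by linarith))
      intro a b c g hg h₁ h₂
      rw [pow_succ] at h₁
      obtain ⟨i₁, i₂, i₃, i₄, -⟩ := id hg
      obtain ⟨g₁, hg₁⟩ := exists_isRotation (hpq := hpq) (a := a) (b := (a + b) / 2)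
        (c := (a + b) / 2 + (c - b)) (by linarith) (by linarith) (by linarith) (by linarith)
      obtain ⟨g₂, hg₂⟩ := exists_isRotation (hpq := hpq) (a := (a + b) / 2) (b := b)
        (c := c) (by linarith) (by linarith) (by linarith) (by linarith)
      rw [hg.eq_mul_of_left hg₁ hg₂]
      exact mul_mem (half _ _ _ _ hg₁ (by linarith) (by linarith))
        (half _ _ _ _ hg₂ (by linarith) (by linarith))
  obtain ⟨n, hn⟩ := pow_unbounded_of_one_lt ((q - p) / (δ / 3)) (one_lt_two)
  rw [div_lt_iff₀ (by positivity)] at hn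
  obtain ⟨i₁, i₂, i₃, i₄, -⟩ := id hg
  exact key n a b c g hg (by linarith) (by linarith)

/-- Sorting the pieces from left to right: if `f` fixes everything below `P i`, one swap brings the
image of the next piece back home. The partition `P` never needs refining, and `m` counts the pieces
still to be placed. -/
theorem mem_closure_isRotation {k : ℕ} {P : Fin (k + 1) → ℝ} (hP : StrictMono P) (h0 : P 0 = p)
    (h1 : P (Fin.last k) = q) : ∀ (m : ℕ) (i : Fin (k + 1)), (i : ℕ) + m = k →
    ∀ (f : intervalExchangeGroup p q hpq) (t : Fin k → ℝ),
      (∀ (j : Fin k) (x : Set.Ico p q), (x : ℝ) ∈ Set.Ico (P j.castSucc) (P j.succ) →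
        ((f • x : Set.Ico p q) : ℝ) = x + t j) →
      (∀ x : Set.Ico p q, (x : ℝ) < P i → f • x = x) →
      f ∈ Subgroup.closure {g : intervalExchangeGroup p q hpq | ∃ a b c, IsRotation g a b c} := by
  intro m
  induction m with
  | zero =>
    intro i hi f t _ hfix
    have hi : i = Fin.last k := Fin.ext (by simpa using hi)
    have : f = 1 := FaithfulSMul.eq_of_smul_eq_smul (α := Set.Ico p q) fun x => by
      rw [one_smul, hfix x (by rw [hi, h1]; exact x.2.2)]
    rw [this]
    exact one_mem _
  | succ m ih =>
    intro i hi f t hf hfix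
    obtain ⟨i, rfl⟩ : ∃ j : Fin k, i = j.castSucc := ⟨⟨i, by omega⟩, rfl⟩
    have hPi : P i.castSucc < P i.succ := hP i.castSucc_lt_succ
    have hleft : ∀ j : Fin k, P j.castSucc ∈ Set.Ico p q := fun j =>
      ⟨h0 ▸ hP.monotone (Fin.zero_le _), h1 ▸ hP (Fin.castSucc_lt_last j)⟩
    have hsucc : ∀ j : Fin k, P j.succ ≤ q := fun j => h1 ▸ hP.monotone (Fin.le_last _)
    have hfi := hf i ⟨_, hleft i⟩ ⟨le_rfl, hPi⟩
    have hinj : ∀ x y : Set.Ico p q, ((f • x : Set.Ico p q) : ℝ) = (f • y : Set.Ico p q) →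
        x = y := fun x y h => MulAction.injective f (Subtype.ext h)
    have ht : 0 ≤ t i := by
      by_contra hlt
      have hfe := hfix (f • ⟨_, hleft i⟩) (by rw [hfi]; simp only; linarith)
      have := hinj _ _ (congrArg Subtype.val hfe)
      rw [this] at hfi
      simp only at hfi
      linarith
    have hq : P i.succ + t i ≤ q := by
      by_contra hlt
      have hyI : max (P i.castSucc) (q - t i) ∈ Set.Ico p q :=
        ⟨(hleft i).1.trans (le_max_left _ _), max_lt (hleft i).2
          (by linarith [hsucc i])⟩
      have := hf i ⟨_, hyI⟩ ⟨le_max_left _ _, max_lt hPi (by linarith)⟩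
      have h2 := (f • (⟨_, hyI⟩ : Set.Ico p q)).2.2
      rw [this] at h2
      simp only at h2
      linarith [le_max_right (P i.castSucc) (q - t i)]
    -- The swap `r` exchanges the image of piece `i` with the gap between its home and that image.
    obtain ⟨r, hr⟩ := exists_isRotation (hpq := hpq) (a := P i.castSucc) (b := P i.castSucc + t i)
      (c := P i.succ + t i) (hleft i).1 (by linarith) (by linarith) hq
    have hlow : ∀ x : Set.Ico p q, P i.castSucc ≤ x →
        P i.castSucc ≤ (f • x : Set.Ico p q) := by
      intro x hx
      by_contra hlt
      have hlt := not_le.1 hlt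
      have := hinj _ _ (congrArg Subtype.val (hfix _ hlt))
      rw [this] at hlt
      linarith
    have hout : ∀ x : Set.Ico p q, P i.succ ≤ x →
        (f • x : Set.Ico p q) ∉ {y : Set.Ico p q | P i.castSucc + t i ≤ y ∧ y < P i.succ + t i} := by
      rintro x hx ⟨h₁, h₂⟩
      have hyI : ((f • x : Set.Ico p q) : ℝ) - t i ∈ Set.Ico p q :=
        ⟨by linarith [(hleft i).1], by linarith [(f • x : Set.Ico p q).2.2]⟩
      have hy := hf i ⟨_, hyI⟩ ⟨by simp only; linarith, by simp only; linarith⟩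
      have := hinj ⟨_, hyI⟩ x (by rw [hy]; simp)
      have := congrArg Subtype.val this
      simp only at this
      linarith
    have hrf : r * f ∈
        Subgroup.closure {g : intervalExchangeGroup p q hpq | ∃ a b c, IsRotation g a b c} := by
      have hfixed : ∀ x : Set.Ico p q, (x : ℝ) < P i.succ → (r * f) • x = x := by
        intro x hx
        refine Subtype.ext ?_
        rw [mul_smul, hr.apply_eq]
        rcases lt_or_ge (x : ℝ) (P i.castSucc) with h | h
        · rw [hfix x h, rotationFun_of_lt h]
        · rw [hf i x ⟨h, hx⟩, rotationFun_right (by linarith) (by linarith) (by linarith)]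
          ring
      -- The new translation lengths are read off at the left endpoints. On a later piece `r * f` is
      -- still a translation, because its image under `f` avoids the image of piece `i` and so lies
      -- on one side of it.
      refine ih i.succ (by simp at hi ⊢; omega) (r * f)
        (fun j => ((r * f) • (⟨_, hleft j⟩ : Set.Ico p q) : Set.Ico p q) - P j.castSucc) ?_ hfixed
      intro j x hx
      rcases lt_or_ge i j with hij | hij
      · have hPj : P i.succ ≤ P j.castSucc := hP.monotone (by
          rw [Fin.le_def]; simp; omega)
        have hj := hf j ⟨_, hleft j⟩ ⟨le_rfl, hP j.castSucc_lt_succ⟩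
        have hx' := hf j x hx
        have l₁ := hlow ⟨_, hleft j⟩ (by simp only; linarith)
        have l₂ := hlow x (by linarith [hx.1])
        have o₁ := hout ⟨_, hleft j⟩ hPj
        rw [mul_smul, mul_smul, hr.apply_eq, hr.apply_eq, hj, hx']
        rw [hj] at l₁
        rw [hx'] at l₂
        rw [Set.mem_ofPred_eq, hj] at o₁
        simp only at l₁ o₁ ⊢
        rcases lt_or_ge (P j.castSucc + t j) (P i.castSucc + t i) with h | h
        · have h' : (x : ℝ) + t j < P i.castSucc + t i := by
            by_contra hge
            have hge := not_lt.1 hge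
            -- If the image of piece `j` straddled the left end of the image of piece `i`, this
            -- point of piece `j` would be sent onto that end.
            have hyI : P i.castSucc + t i - t j ∈ Set.Ico p q :=
              ⟨by linarith [(hleft j).1], by linarith [x.2.2]⟩
            have hy := hf j ⟨_, hyI⟩ ⟨by simp only; linarith, by simp only; linarith [hx.2]⟩
            refine hout ⟨_, hyI⟩ (by simp only; linarith) ?_
            rw [Set.mem_ofPred_eq, hy]
            simp only
            constructor <;> linarith
          rw [rotationFun_left l₁ h (by linarith), rotationFun_left l₂ h' (by linarith)]
          ring
        · have h' : P i.succ + t i ≤ P j.castSucc + t j := by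
            by_contra hlt
            exact o₁ ⟨h, not_le.1 hlt⟩
          rw [rotationFun_of_ge h', rotationFun_of_ge (by linarith [hx.1])]
          ring
      · have hPj : P j.succ ≤ P i.succ := hP.monotone (by
          rw [Fin.le_def] at hij ⊢; simp; omega)
        have hj : P j.castSucc < P j.succ := hP j.castSucc_lt_succ
        rw [hfixed x (by linarith [hx.2]), hfixed ⟨_, hleft j⟩ (by simp only; linarith)]
        simp
    have hrm : r ∈ Subgroup.closure
        {g : intervalExchangeGroup p q hpq | ∃ a b c, IsRotation g a b c} :=
      Subgroup.subset_closure ⟨_, _, _, hr⟩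
    exact (Subgroup.mul_mem_cancel_left _ hrm).1 hrf

theorem closure_smallRotations {δ : ℝ} (hδ : 0 < δ) :
    Subgroup.closure (smallRotations p q hpq δ) = ⊤ := by
  rw [eq_top_iff]
  rintro f -
  obtain ⟨k, P, hP, h0, h1, t, ht⟩ := f.2
  have hf := mem_closure_isRotation (hpq := hpq) hP h0 h1 k 0 (by simp) f t ht
    (fun x hx => by rw [h0] at hx; linarith [x.2.1])
  refine (Subgroup.closure_le _).2 ?_ hf
  rintro g ⟨a, b, c, hg⟩
  exact hg.mem_closure_smallRotations hδ

/-! ### Displacement and conclusion -/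

/-- A nontrivial interval exchange moves some subinterval off itself. -/
theorem exists_displaced {n : intervalExchangeGroup p q hpq} (hn : n ≠ 1) :
    ∃ x ε : ℝ, 0 < ε ∧ p ≤ x ∧ x + ε ≤ q ∧ ∀ y : Set.Ico p q, (y : ℝ) ∈ Set.Ico x (x + ε) →
      ((n • y : Set.Ico p q) : ℝ) ∉ Set.Ico x (x + ε) := by
  obtain ⟨x, hx⟩ : ∃ x : Set.Ico p q, n • x ≠ x := by
    by_contra h
    push Not at h
    exact hn (FaithfulSMul.eq_of_smul_eq_smul (α := Set.Ico p q) fun x => by rw [h x, one_smul])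
  obtain ⟨k, P, hP, h0, h1, t, ht⟩ := n.2
  obtain ⟨i, hi⟩ := IsIntervalExchange.exists_piece k P x (h0 ▸ x.2.1) (h1 ▸ x.2.2)
  have hti : t i ≠ 0 := fun h => hx (Subtype.ext ((ht i x hi).trans (by rw [h, add_zero])))
  -- Short enough to stay in one piece, and no longer than the distance it is moved.
  refine ⟨x, min (P i.succ - x) |t i|, lt_min (by linarith [hi.2]) (abs_pos.2 hti), x.2.1, ?_, ?_⟩
  · have : P i.succ ≤ q := h1 ▸ hP.monotone (Fin.le_last _)
    linarith [min_le_left (P i.succ - x) |t i|]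
  · intro y hy hny
    have e : ((n • y : Set.Ico p q) : ℝ) = y + t i :=
      ht i y ⟨hi.1.trans hy.1, by linarith [hy.2, min_le_left (P i.succ - x) |t i|]⟩
    rw [e] at hny
    have h₂ := min_le_right (P i.succ - x) |t i|
    obtain ⟨a₁, a₂⟩ := hy
    obtain ⟨b₁, b₂⟩ := hny
    rcases abs_cases (t i) with ⟨h, -⟩ | ⟨h, -⟩ <;> linarith

theorem exists_not_commute : ∃ s t : intervalExchangeGroup p q hpq, ¬ Commute s t := by
  obtain ⟨s, hs⟩ := exists_isRotation (hpq := hpq) (a := p) (b := p + (q - p) / 3)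
    (c := p + 2 * ((q - p) / 3)) (by linarith) (by linarith) (by linarith) (by linarith)
  obtain ⟨t, ht⟩ := exists_isRotation (hpq := hpq) (a := p + (q - p) / 3)
    (b := p + 2 * ((q - p) / 3)) (c := q) (by linarith) (by linarith) (by linarith) (by linarith)
  refine ⟨s, t, fun hst => ?_⟩
  -- `s * t` sends `p` to the first third point, `t * s` to the second.
  have h := congrArg (fun g => ((g • (⟨p, le_rfl, hpq⟩ : Set.Ico p q) : Set.Ico p q) : ℝ)) hst.eq
  simp only [mul_smul, hs.apply_eq, ht.apply_eq] at h
  rw [rotationFun_of_lt (a := p + (q - p) / 3) (x := p) (by linarith),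
    rotationFun_left (a := p) le_rfl (by linarith) (by linarith),
    rotationFun_left (a := p + (q - p) / 3) (by linarith) (by linarith) (by linarith)] at h
  linarith

theorem commutator_le_of_normalized {N : Subgroup (intervalExchangeGroup p q hpq)}
    (hN : ∀ g ∈ commutator (intervalExchangeGroup p q hpq), ∀ n ∈ N, g * n * g⁻¹ ∈ N)
    {n : intervalExchangeGroup p q hpq} (hn : n ∈ N) (hn1 : n ≠ 1) :
    commutator (intervalExchangeGroup p q hpq) ≤ N := by
  obtain ⟨x, ε, hε, hpx, hxq, hdis⟩ := exists_displaced hn1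
  obtain ⟨δ, rfl⟩ : ∃ δ, ε = 3 * δ := ⟨ε / 3, by ring⟩
  obtain ⟨h, hh⟩ := exists_translate (hpq := hpq) (a := x) (x := x + δ) (l := δ) hpx
    (by linarith) (by linarith) (by linarith)
  obtain ⟨k, hk⟩ := exists_translate (hpq := hpq) (a := x) (x := x + 2 * δ) (l := δ) hpx
    (by linarith) (by linarith) (by linarith)
  -- Generators have support shorter than `δ / 2`, so two overlapping ones fit together in an
  -- interval shorter than `δ`, the length of `J`.
  refine commutator_le_of_displacement hN hn
    (J := {y : Set.Ico p q | (y : ℝ) ∈ Set.Ico x (x + δ)})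
    (K := {y : Set.Ico p q | (y : ℝ) ∈ Set.Ico (x + δ) (x + 2 * δ)})
    (L := {y : Set.Ico p q | (y : ℝ) ∈ Set.Ico (x + 2 * δ) (x + 3 * δ)})
    ?_ ?_ ?_ ?_ (h := h) (k := k) ?_ ?_ (closure_smallRotations (δ := δ / 2) (by linarith)) ?_ ?_
  · exact Set.disjoint_left.2 fun y ⟨_, _⟩ ⟨_, _⟩ => by linarith
  · exact Set.disjoint_left.2 fun y ⟨_, _⟩ ⟨_, _⟩ => by linarith
  · exact Set.disjoint_left.2 fun y ⟨_, _⟩ ⟨_, _⟩ => by linarith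
  · intro y hy hny
    refine hdis y ?_ ?_
    · rcases hy with ⟨_, _⟩ | ⟨_, _⟩ <;> constructor <;> linarith
    · rcases hny with (⟨_, _⟩ | ⟨_, _⟩) | ⟨_, _⟩ <;> constructor <;> linarith
  · intro y hy
    rw [Set.mem_ofPred_eq, hh y hy]
    obtain ⟨_, _⟩ := hy
    constructor <;> linarith
  · intro y hy
    rw [Set.mem_ofPred_eq, hk y hy]
    obtain ⟨_, _⟩ := hy
    constructor <;> linarith
  · rintro s ⟨a, b, c, hs, hac⟩
    obtain ⟨i₁, i₂, i₃, i₄, -⟩ := id hs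
    obtain ⟨g, hg⟩ := exists_translate (hpq := hpq) (a := a) (x := x + δ) (l := c - a) i₁
      (by linarith) (by linarith) (by linarith)
    rw [add_sub_cancel] at hg
    refine ⟨g, hs.supportedIn.conj fun y hy hny => ?_⟩
    rw [Set.mem_ofPred_eq, hg y hy] at hny
    linarith [hny.2, hy.1]
  · rintro s ⟨a, b, c, hs, hac⟩ t ⟨a', b', c', ht, hac'⟩
    by_cases hd : c ≤ a' ∨ c' ≤ a
    · refine Or.inl (hs.supportedIn.commute ht.supportedIn
        (Set.disjoint_left.2 fun y ⟨_, _⟩ ⟨_, _⟩ => ?_))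
      rcases hd with hd | hd <;> linarith
    · push Not at hd
      obtain ⟨i₁, i₂, i₃, i₄, -⟩ := id hs
      obtain ⟨j₁, j₂, j₃, j₄, -⟩ := id ht
      have hlen : max c c' - min a a' < δ := by
        rcases max_cases c c' with ⟨e, -⟩ | ⟨e, -⟩ <;>
          rcases min_cases a a' with ⟨e', -⟩ | ⟨e', -⟩ <;> rw [e, e'] <;> linarith
      obtain ⟨g, hg⟩ := exists_translate (hpq := hpq) (a := min a a') (x := x)
        (l := max c c' - min a a') (le_min i₁ j₁) (by rw [add_sub_cancel]; exact max_le i₄ j₄) hpx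
        (by linarith)
      rw [add_sub_cancel] at hg
      have hmove : ∀ y : Set.Ico p q, (y : ℝ) ∈ Set.Ico (min a a') (max c c') →
          g • y ∈ {y : Set.Ico p q | (y : ℝ) ∈ Set.Ico x (x + δ)} := by
        intro y hy
        rw [Set.mem_ofPred_eq, hg y hy]
        obtain ⟨_, _⟩ := hy
        constructor <;> linarith
      exact Or.inr ⟨g,
        hs.supportedIn.conj fun y hy => hmove y
          ⟨(min_le_left _ _).trans hy.1, hy.2.trans_le (le_max_left _ _)⟩,
        ht.supportedIn.conj fun y hy => hmove y
          ⟨(min_le_right _ _).trans hy.1, hy.2.trans_le (le_max_right _ _)⟩⟩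

theorem theorem3 (p q : ℝ) (hpq : p < q) :
    IsSimpleGroup (commutator (intervalExchangeGroup p q hpq)) := by
  exact isSimpleGroup_commutator_of_forall exists_not_commute
    fun _ hN _ hn hn1 => commutator_le_of_normalized hN hn hn1
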